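/- An automaton $A=(S,X,\lambda)$ consists of a set of states $S$, an alphabet $X$ and a map $\lambda:S\times X\to X\times S$; we write $s\xrightarrow{x|y}t$ (an arrow of $A$) when $\lambda(s,x)=(y,t)$. The dual $\partial A$ has the arrows $x^{-1}\xrightarrow{s^{-1}|t^{-1}}y^{-1}$, and the inverse $\mathrm{i}A$ the arrows $s^{-1}\xrightarrow{y|x}t^{-1}$, one for each arrow $s\xrightarrow{x|y}t$ of $A$ (formal inverses are labels with $(z^{-1})^{-1}=z$). A finite automaton $A$ is bireversible if all eight automata $A,\ \partial A,\ \mathrm{i}A,\ \mathrm{i}\partial A,\ \partial \mathrm{i}A,\ \partial \mathrm{i}\partial A,\ \mathrm{i}\partial \mathrm{i}A,\ \mathrm{i}\partial \mathrm{i}\partial A$ are complete and deterministic, i.e. for each state and each input letter there is exactly one arrow leaving that state with that input letter. Each state $s$ of a bireversible automaton acts on the set $X^*$ of finite words by a permutation: $s(xw)=y\,t(w)$ if $s\xrightarrow{x|y}t$, and the empty word is fixed. The automaton group $G_A$ is the quotient of the free group $F_S$ by the kernel of the resulting action on $X^*$. The square complex $\Delta_A$ has one vertex, a directed loop for every $s\in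 S$ and every $x\in X$, and for each arrow $s\xrightarrow{x|y}t$ a square with left side $s$, top side $x$, bottom side $y$ and right side $t$; thus $$\pi_1(\Delta_A)=\langle S,X \mid sx=yt \text{ for each arrow } s\xrightarrow{x|y}t \text{ of } A\rangle .$$ **Theorem.** Let $A=(S,X,\lambda)$ be a finite bireversible automaton over an alphabet with exactly two letters or with exactly two states. If $G_A$ is infinite, then $\pi_1(\Delta_A)$ is not residually finite. Consequently, the following two groups are not residually finite: (1) the fundamental group of the Wise complex, that is, of $\Delta_A$ for the Aleshin automaton $A$ with states $a,b,c$, alphabet $\{0,1\}$ and arrows $a\xrightarrow{0|0}b$, $a\xrightarrow{1|1}b$, $b\xrightarrow{0|1}a$, $b\xrightarrow{1|0}c$, $c\xrightarrow{0|1}c$, $c\xrightarrow{1|0}a$; (2) the fundamental group of $\Delta_B$ for the Bellaterra automaton $B$ with states $a,b,c$, alphabet $\{0,1\}$ and arrows $a\xrightarrow{0|1}b$, $a\xrightarrow{1|0}b$, $b\xrightarrow{0|0}a$, $b\xrightarrow{1|1}c$, $c\xrightarrow{0|0}c$, $c\xrightarrow{1|1}a$. -/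

import Mathlib

/-- A (complete deterministic Mealy) automaton `(S, X, λ)` with set of states `S`, input and output
alphabet `X`, and transition map `λ : S × X → X × S`; the equality `λ (s, x) = (y, t)` is the
arrow `s --x|y--> t`. -/
structure MealyAutomaton (S X : Type*) where
  /-- The transition map. -/
  step : S × X → X × S

/-- A set of labelled arrows, i.e. a not necessarily complete or deterministic automaton:
`R s x y t` means that there is an arrow `s --x|y--> t`. -/
def ArrowSet (S X : Type*) := S → X → X → S → Prop

namespace ArrowSet

variable {S X : Type*}

/-- The set of arrows is complete and deterministic. -/
def IsAutomaton (R : ArrowSet S X) : Prop :=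
  ∀ s x, ∃! p : X × S, R s x p.1 p.2

/-- The dual: an arrow `s --x|y--> t` gives the arrow `x⁻¹ --s⁻¹|t⁻¹--> y⁻¹`. The formal inverses
are only labels, so the sets `X⁻¹` and `S⁻¹` are identified with `X` and `S`. -/
def dual (R : ArrowSet S X) : ArrowSet X S :=
  fun x s t y => R s x y t

/-- The inverse: an arrow `s --x|y--> t` gives the arrow `s⁻¹ --y|x--> t⁻¹`, where again `S⁻¹` is
identified with `S`. -/
def inverse (R : ArrowSet S X) : ArrowSet S X :=
  fun s y x t => R s x y t

end ArrowSet

namespace MealyAutomaton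

variable {S X : Type*} (A : MealyAutomaton S X)

/-- The arrows of an automaton. -/
def arrows : ArrowSet S X :=
  fun s x y t => A.step (s, x) = (y, t)

/-- An automaton is invertible if its inverse is complete and deterministic. -/
def Invertible : Prop := A.arrows.inverse.IsAutomaton

/-- An automaton `A` is bireversible if all eight automata
`A, ∂A, iA, i∂A, ∂iA, ∂i∂A, i∂iA, i∂i∂A` (`∂` the dual, `i` the inverse) are complete and
deterministic. -/
structure Bireversible : Prop where
  self : A.arrows.IsAutomaton
  d : A.arrows.dual.IsAutomaton
  i : A.arrows.inverse.IsAutomaton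
  id : A.arrows.dual.inverse.IsAutomaton
  di : A.arrows.inverse.dual.IsAutomaton
  did : A.arrows.dual.inverse.dual.IsAutomaton
  idi : A.arrows.inverse.dual.inverse.IsAutomaton
  idid : A.arrows.dual.inverse.dual.inverse.IsAutomaton

theorem Bireversible.invertible {A : MealyAutomaton S X} (h : A.Bireversible) : A.Invertible := h.i

/-- The transformation of the set `X*` of words defined by a state: if `λ (s, x) = (y, t)` then
`s (x w) = y t(w)`. -/
def act : S → List X → List X
  | _, [] => []
  | s, x :: w => (A.step (s, x)).1 :: act (A.step (s, x)).2 w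

/-- If the automaton is invertible, then its states act by permutations of `X*`. -/
theorem act_bijective (h : A.Invertible) (s : S) : Function.Bijective (A.act s) := by
  constructor
  · intro u
    induction u generalizing s with
    | nil =>
      intro v huv
      cases v with
      | nil => rfl
      | cons y v => simp [act] at huv
    | cons x u ih =>
      intro v huv
      cases v with
      | nil => simp [act] at huv
      | cons y v =>
        simp only [act, List.cons.injEq] at huv
        obtain ⟨h1, h2⟩ := huv
        have key := (h s (A.step (s, x)).1).unique (y₁ := (x, (A.step (s, x)).2))
          (y₂ := (y, (A.step (s, y)).2)) rfl (by
            change A.step (s, y) = _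
            rw [h1])
        obtain rfl : x = y := congrArg Prod.fst key
        rw [ih _ h2]
  · intro v
    induction v generalizing s with
    | nil => exact ⟨[], rfl⟩
    | cons y v ih =>
      obtain ⟨⟨x, t⟩, hx, -⟩ := h s y
      obtain ⟨u, hu⟩ := ih t
      have hx' : A.step (s, x) = (y, t) := hx
      exact ⟨x :: u, by simp [act, hx', hu]⟩

/-- The permutation of `X*` defined by a state of an invertible automaton. -/
noncomputable def actPerm (h : A.Invertible) (s : S) : Equiv.Perm (List X) :=
  Equiv.ofBijective (A.act s) (A.act_bijective h s)

/-- The action of the free group on the states of an invertible automaton on `X*`. -/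
noncomputable def freeAction (h : A.Invertible) : FreeGroup S →* Equiv.Perm (List X) :=
  FreeGroup.lift (A.actPerm h)

/-- The automaton group `G_A`: the quotient of the free group on the states by the kernel of its
action on `X*`. -/
abbrev AutomatonGroup (h : A.Invertible) : Type _ :=
  FreeGroup S ⧸ (A.freeAction h).ker

end MealyAutomaton

/-- A square complex with the given directed graph as its `1`-skeleton: a combinatorial `2`-complex
each of whose `2`-cells is attached along a closed edge path of length four. The edge paths
traverse edges in either direction, i.e. they are paths in the symmetrified quiver. -/
structure SquareComplex (V : Type*) [Quiver V] where
  /-- The set of `2`-cells. -/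
  Square : Type*
  /-- The initial vertex of the boundary of a square. -/
  base : Square → V
  /-- The attaching path of a square. -/
  bdry : ∀ c : Square,
    Quiver.Path (V := Quiver.Symmetrify V) (base c : V) (base c : V)
  length_bdry : ∀ c, (bdry c).length = 4

section

open CategoryTheory

namespace SquareComplex

variable {V : Type*} [Quiver V] (K : SquareComplex V)

/-- The class of an edge path in the fundamental groupoid of the `1`-skeleton, that is, its class
up to insertion and removal of backtracking. -/
def pathClass {v w : V} (p : Quiver.Path (V := Quiver.Symmetrify V) (v : V) (w : V)) :
    (⟨v⟩ : Quiver.FreeGroupoid V) ⟶ (⟨w⟩ : Quiver.FreeGroupoid V) :=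
  (CategoryTheory.Quotient.functor (@Quiver.FreeGroupoid.redStep V _)).map p

/-- Elementary homotopies across the `2`-cells: the boundary of a square is contracted. -/
inductive CellHomotopy : HomRel (Quiver.FreeGroupoid V)
  | square (c : K.Square) : CellHomotopy (pathClass (K.bdry c)) (𝟙 _)

/-- The (edge path) fundamental groupoid: the edge paths up to backtracking and elementary
homotopies across the `2`-cells. -/
abbrev EdgePathGroupoid : Type _ := CategoryTheory.Quotient K.CellHomotopy

/-- The (edge path) fundamental group of the complex at a vertex: the closed edge paths at the vertex
up to homotopy, with concatenation as multiplication. -/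
def FundamentalGroup (v : V) : Type _ :=
  (⟨⟨v⟩⟩ : K.EdgePathGroupoid) ⟶ (⟨⟨v⟩⟩ : K.EdgePathGroupoid)

noncomputable instance (v : V) : Group (K.FundamentalGroup v) :=
  Groupoid.vertexGroup (⟨⟨v⟩⟩ : K.EdgePathGroupoid)

end SquareComplex

end

/-- The only vertex of the bouquet of directed loops indexed by the states `S` and the
letters `X`. -/
inductive Bouquet (S X : Type*) : Type
  | pt

instance (S X : Type*) : Quiver (Bouquet S X) where
  Hom _ _ := S ⊕ X

namespace Bouquet

variable {S X : Type*}

/-- The (vertical) loop of a state. -/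
def vert (s : S) : (pt : Bouquet S X) ⟶ pt := Sum.inl s

/-- The (horizontal) loop of a letter. -/
def horiz (x : X) : (pt : Bouquet S X) ⟶ pt := Sum.inr x

end Bouquet

namespace MealyAutomaton

variable {S X : Type*} (A : MealyAutomaton S X)

/-- The square complex `Δ_A`: it has one vertex, a directed loop for every state and every letter,
and for every arrow `s --x|y--> t` a square with left side `s`, top side `x`, right side `t` and
bottom side `y` (vertical sides directed upwards, horizontal sides to the right), so that its
boundary read from the lower left corner is `s x t⁻¹ y⁻¹`. -/
def squareComplex : SquareComplex (Bouquet S X) where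
  Square := S × X
  base _ := .pt
  bdry c :=
    (((Quiver.Path.nil.cons (Bouquet.vert c.1).toPos).cons
      (Bouquet.horiz c.2).toPos).cons
      (Bouquet.vert (A.step c).2).toNeg).cons
      (Bouquet.horiz (A.step c).1).toNeg
  length_bdry _ := rfl

/-- The fundamental group of the square complex of an automaton. -/
abbrev PiOne : Type _ := A.squareComplex.FundamentalGroup .pt

end MealyAutomaton

/-- The set of states `{a, b, c}` of the Aleshin and Bellaterra automata. -/
inductive StateABC
  | a | b | c

/-- The Aleshin automaton, over the alphabet `{0, 1}`. Its square complex is the Wise complex. -/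
def aleshin : MealyAutomaton StateABC (Fin 2) where
  step
    | (.a, 0) => (0, .b)
    | (.a, 1) => (1, .b)
    | (.b, 0) => (1, .a)
    | (.b, 1) => (0, .c)
    | (.c, 0) => (1, .c)
    | (.c, 1) => (0, .a)

/-- The Bellaterra automaton, over the alphabet `{0, 1}`. -/
def bellaterra : MealyAutomaton StateABC (Fin 2) where
  step
    | (.a, 0) => (1, .b)
    | (.a, 1) => (0, .b)
    | (.b, 0) => (0, .a)
    | (.b, 1) => (1, .c)
    | (.c, 0) => (0, .c)
    | (.c, 1) => (1, .a)

/-- The Wise complex `Δ_W`. -/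
abbrev wiseComplex : SquareComplex (Bouquet StateABC (Fin 2)) := aleshin.squareComplex

/-- The square complex of the Bellaterra automaton. -/
abbrev bellaterraComplex : SquareComplex (Bouquet StateABC (Fin 2)) := bellaterra.squareComplex

/-! Take two letters x₀, x₁ and put c = x₀x₁⁻¹. Each state s satisfies sc = c^{±1}t for a state t,
and the sign is constant along the orbits of a permutation of the finite set of states. So some
power c^N is centralized or inverted by every state (`exists_pow_normalized`).

In a finite quotient Q, let P be the subgroup that centralizes or inverts the image of c^N. It
contains the states, and sw = s(w)t for a word w, so membership of w in P is invariant under the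
automaton group. If that group is transitive on each level, then x₀^{2|Q|} = 1 puts all words of
length 2|Q| in P. Two words that differ only in the second letter show that b = x₀x₀x₁⁻¹x₀⁻¹ lies in
P, so b² commutes with c^N in every finite quotient. The letters generate a free subgroup of the
fundamental group (`lift_piHoriz_injective`), and there b² and c^N do not commute.

Over two letters, an infinite automaton group is level transitive (`levelTransitive_of_infinite`).
The case of two states is the same argument for the dual, whose group is infinite as well
(`finite_automatonGroup_of_dual`). For the two examples, transitivity comes directly from a parity
count (`levelTransitive_of_activity`). -/

namespace MealyAutomaton

/-! ### Commutation of states with words, and the normalized power -/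

variable {S X : Type*} {A : MealyAutomaton S X}

theorem Bireversible.letter_injective (h : A.Bireversible) {s : S} {x x' : X}
    (hx : (A.step (s, x)).1 = (A.step (s, x')).1) : x = x' := by
  have key := (h.i s (A.step (s, x)).1).unique (y₁ := (x, (A.step (s, x)).2))
    (y₂ := (x', (A.step (s, x')).2)) rfl (by
      change A.step (s, x') = _
      rw [hx])
  exact congrArg Prod.fst key

theorem Bireversible.step_injective (h : A.Bireversible) : Function.Injective A.step := by
  rintro ⟨s, x⟩ ⟨s', x'⟩ hs
  have key := (h.idi (A.step (s, x)).1 (A.step (s, x)).2).unique (y₁ := (s, x)) (y₂ := (s', x'))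
    rfl hs.symm
  exact key

/-- For a given input letter, the target state determines the source state. -/
theorem Bireversible.next_bijective (h : A.Bireversible) (x : X) :
    Function.Bijective fun s => (A.step (s, x)).2 := by
  constructor
  · intro s s' hs
    have key := (h.id x (A.step (s, x)).2).unique (y₁ := (s, (A.step (s, x)).1))
      (y₂ := (s', (A.step (s', x)).1)) rfl (by
        change A.step (s', x) = _
        dsimp only at hs
        rw [hs])
    exact congrArg Prod.fst key
  · intro t
    obtain ⟨⟨s, y⟩, hs, -⟩ := h.id x t
    have hs' : A.step (s, x) = (y, t) := hs
    exact ⟨s, by simp [hs']⟩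

theorem Bireversible.exists_step_eq (h : A.Bireversible) (y : X) (t : S) :
    ∃ s x, A.step (s, x) = (y, t) := by
  obtain ⟨⟨s, x⟩, hs, -⟩ := h.idi y t
  exact ⟨s, x, hs⟩

/-- The permutation of the states induced by an input letter. -/
noncomputable def Bireversible.next (h : A.Bireversible) (x : X) : Equiv.Perm S :=
  Equiv.ofBijective _ (h.next_bijective x)

theorem Bireversible.next_apply (h : A.Bireversible) (x : X) (s : S) :
    h.next x s = (A.step (s, x)).2 := rfl

/-- The state reached after reading a word. -/
def sectionAt (A : MealyAutomaton S X) : S → List X → S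
  | s, [] => s
  | s, x :: w => A.sectionAt (A.step (s, x)).2 w

/-- The group of permutations of `X*` generated by the states is transitive on the words of each
length. -/
def LevelTransitive (A : MealyAutomaton S X) (h : A.Invertible) : Prop :=
  ∀ u v : List X, u.length = v.length → ∃ g, A.freeAction h g u = v

section Relation

variable {Γ : Type*} [Group Γ] {σ : S → Γ} {ξ : X → Γ}

theorem mul_prod_map (rel : ∀ s x, σ s * ξ x = ξ (A.step (s, x)).1 * σ (A.step (s, x)).2)
    (s : S) (w : List X) :
    σ s * (w.map ξ).prod = ((A.act s w).map ξ).prod * σ (A.sectionAt s w) := by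
  induction w generalizing s with
  | nil => simp [act, sectionAt]
  | cons x w ih =>
    simp only [act, sectionAt, List.map_cons, List.prod_cons]
    rw [← mul_assoc, rel, mul_assoc, ih, mul_assoc]

/-- In `mul_prod_map` the states on both sides lie in `P`, so they can be cancelled from the
membership condition. -/
theorem prod_map_mem_iff (rel : ∀ s x, σ s * ξ x = ξ (A.step (s, x)).1 * σ (A.step (s, x)).2)
    (h : A.Invertible) (P : Subgroup Γ) (hP : ∀ s, σ s ∈ P) (g : FreeGroup S) (w : List X) :
    ((A.freeAction h g w).map ξ).prod ∈ P ↔ (w.map ξ).prod ∈ P := by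
  induction g using FreeGroup.induction_on generalizing w with
  | C1 => simp
  | of s =>
    have : A.freeAction h (FreeGroup.of s) w = A.act s w := by
      simp [freeAction, actPerm]
    have key := mul_prod_map rel s w
    rw [this, ← P.mul_mem_cancel_right (hP (A.sectionAt s w)), ← key,
      P.mul_mem_cancel_left (hP s)]
  | inv_of s ih =>
    rw [← ih (A.freeAction h (FreeGroup.of s)⁻¹ w)]
    rw [← Equiv.Perm.mul_apply, ← map_mul, mul_inv_cancel, map_one, Equiv.Perm.one_apply]
  | mul a b ha hb => rw [map_mul, Equiv.Perm.mul_apply, ha, hb]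

end Relation

/-- In a two-letter bireversible automaton, the states normalize a positive power of
`ξ x₀ * (ξ x₁)⁻¹`. -/
theorem Bireversible.exists_pow_normalized [Finite S] (hA : A.Bireversible) {x₀ x₁ : X}
    (hne : x₀ ≠ x₁) (hX : ∀ x, x = x₀ ∨ x = x₁) :
    ∃ N : ℕ, 0 < N ∧ ∀ (Γ : Type*) [Group Γ] (σ : S → Γ) (ξ : X → Γ),
      (∀ s x, σ s * ξ x = ξ (A.step (s, x)).1 * σ (A.step (s, x)).2) → ∀ s,
        σ s * (ξ x₀ * (ξ x₁)⁻¹) ^ N = (ξ x₀ * (ξ x₁)⁻¹) ^ N * σ s ∨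
        σ s * (ξ x₀ * (ξ x₁)⁻¹) ^ N = ((ξ x₀ * (ξ x₁)⁻¹) ^ N)⁻¹ * σ s := by
  -- Reading x₁ from `τ s` ends in the same state as reading x₀ from `s`, so moving `σ s` across `c`
  -- leaves the single state `τ s` on the right.
  set τ : Equiv.Perm S := (hA.next x₁)⁻¹ * hA.next x₀ with hτ
  refine ⟨orderOf τ, orderOf_pos τ, fun Γ _ σ ξ rel s => ?_⟩
  set c := ξ x₀ * (ξ x₁)⁻¹ with hc
  have hnext : ∀ s, (A.step (τ s, x₁)).2 = (A.step (s, x₀)).2 := fun s => by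
    rw [← hA.next_apply, ← hA.next_apply, ← Equiv.Perm.mul_apply, hτ, mul_inv_cancel_left]
  have hout : ∀ s, (A.step (s, x₀)).1 ≠ (A.step (τ s, x₁)).1 := fun s h =>
    hne (congrArg Prod.snd (hA.step_injective (Prod.ext h (hnext s).symm)))
  have hinj : ∀ s, (A.step (s, x₀)).1 ≠ (A.step (s, x₁)).1 := fun s h =>
    hne (hA.letter_injective h)
  have mulc : ∀ s, σ s * c = ξ (A.step (s, x₀)).1 * (ξ (A.step (τ s, x₁)).1)⁻¹ * σ (τ s) := by
    intro s
    rw [hc, ← mul_assoc, rel s x₀, ← hnext, mul_assoc, mul_assoc]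
    congr 1
    rw [mul_inv_eq_iff_eq_mul, mul_assoc, rel, inv_mul_cancel_left]
  -- By `hout`, if `s` fixes x₀ then `τ s` fixes x₁, hence also x₀: the exponent of `c` stays the
  -- same along the `τ`-orbit. Likewise for states that exchange the letters.
  have pos : ∀ s, (A.step (s, x₀)).1 = x₀ →
      σ s * c = c * σ (τ s) ∧ (A.step (τ s, x₀)).1 = x₀ := by
    intro s hs
    have h1 : (A.step (τ s, x₁)).1 = x₁ := (hX _).resolve_left fun h => hout s (hs.trans h.symm)
    refine ⟨by rw [mulc, hs, h1], (hX _).resolve_right fun h => hinj _ (h.trans h1.symm)⟩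
  have neg : ∀ s, (A.step (s, x₀)).1 = x₁ →
      σ s * c = c⁻¹ * σ (τ s) ∧ (A.step (τ s, x₀)).1 = x₁ := by
    intro s hs
    have h1 : (A.step (τ s, x₁)).1 = x₀ := (hX _).resolve_right fun h => hout s (hs.trans h.symm)
    refine ⟨by rw [mulc, hs, h1, hc]; group,
      (hX _).resolve_left fun h => hinj _ (h.trans h1.symm)⟩
  rcases hX (A.step (s, x₀)).1 with hs | hs
  · left
    have key : ∀ k : ℕ, σ s * c ^ k = c ^ k * σ ((τ ^ k) s) ∧
        (A.step ((τ ^ k) s, x₀)).1 = x₀ := by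
      intro k
      induction k with
      | zero => simpa using hs
      | succ k ih =>
        obtain ⟨h1, h2⟩ := pos _ ih.2
        rw [pow_succ' τ, Equiv.Perm.mul_apply]
        exact ⟨by rw [pow_succ, ← mul_assoc, ih.1, mul_assoc, h1, ← mul_assoc], h2⟩
    simpa [pow_orderOf_eq_one] using (key (orderOf τ)).1
  · right
    have key : ∀ k : ℕ, σ s * c ^ k = (c ^ k)⁻¹ * σ ((τ ^ k) s) ∧
        (A.step ((τ ^ k) s, x₀)).1 = x₁ := by
      intro k
      induction k with
      | zero => simpa using hs
      | succ k ih =>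
        obtain ⟨h1, h2⟩ := neg _ ih.2
        rw [pow_succ' τ, Equiv.Perm.mul_apply]
        exact ⟨by rw [pow_succ, ← mul_assoc, ih.1, mul_assoc, h1]; group, h2⟩
    simpa [pow_orderOf_eq_one] using (key (orderOf τ)).1

end MealyAutomaton

/-! ### A noncommutation in free groups -/

/-- For distinct generators `x` and `y` of a free group, the square of `x x y⁻¹ x⁻¹` commutes with
no positive power of `x y⁻¹`. -/
theorem FreeGroup.sq_conj_mul_pow_ne {X : Type*} {x y : X} (hne : x ≠ y) {N : ℕ} (hN : 0 < N) :
    (of x * of x * (of y)⁻¹ * (of x)⁻¹) ^ 2 * (of x * (of y)⁻¹) ^ N ≠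
      (of x * (of y)⁻¹) ^ N * (of x * of x * (of y)⁻¹ * (of x)⁻¹) ^ 2 := by
  classical
  intro h
  -- The images are chosen so that x y⁻¹ maps to the elementary matrix u and its conjugate by x to
  -- the opposite elementary matrix l = w u w⁻¹.
  let w : Matrix.SpecialLinearGroup (Fin 2) ℤ := ⟨!![0, 1; -1, 0], by simp⟩
  let u : Matrix.SpecialLinearGroup (Fin 2) ℤ := ⟨!![1, 1; 0, 1], by simp⟩
  obtain ⟨φ, hx, hy⟩ : ∃ φ : FreeGroup X →* Matrix.SpecialLinearGroup (Fin 2) ℤ,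
      φ (of x) = w ∧ φ (of y) = u⁻¹ * w :=
    ⟨FreeGroup.lift fun z => if z = x then w else u⁻¹ * w, by simp, by simp [hne.symm]⟩
  have hpow : ∀ k : ℕ, ((u ^ k : Matrix.SpecialLinearGroup (Fin 2) ℤ) :
      Matrix (Fin 2) (Fin 2) ℤ) = !![1, (k : ℤ); 0, 1] := by
    intro k
    induction k with
    | zero => simp [Matrix.one_fin_two]
    | succ k ih =>
      rw [pow_succ, Matrix.SpecialLinearGroup.coe_mul, ih]
      simp [u, add_comm]
  replace h := congrArg φ h
  let l : Matrix.SpecialLinearGroup (Fin 2) ℤ := ⟨!![1, 0; -1, 1], by simp⟩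
  have e1 : w * w * (u⁻¹ * w)⁻¹ * w⁻¹ = l := by
    have : w * u = l * w := by
      apply Subtype.ext
      rw [Matrix.SpecialLinearGroup.coe_mul, Matrix.SpecialLinearGroup.coe_mul]
      simp [w, u, l]
    rw [← mul_inv_eq_iff_eq_mul.2 this]
    group
  have e2 : w * (u⁻¹ * w)⁻¹ = u := by group
  simp only [_root_.map_mul, map_pow, _root_.map_inv, hx, hy] at h
  rw [e1, e2] at h
  -- The upper left entry is 1 for l²u^N and 1 - 2N for u^N l².
  have h2 := congrArg (fun M : Matrix.SpecialLinearGroup (Fin 2) ℤ =>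
    (M : Matrix (Fin 2) (Fin 2) ℤ) 0 0) h
  simp only [pow_two, Matrix.SpecialLinearGroup.coe_mul, hpow] at h2
  simp [l] at h2
  omega

/-! ### Level transitivity excludes residual finiteness -/

namespace MealyAutomaton

variable {S X : Type*} {A : MealyAutomaton S X}

/-- Stated for any group with the square relations in which the letters are free, so that it serves
both for an automaton and, through inverse generators, for its dual. -/
theorem LevelTransitive.not_residuallyFinite [Finite S] (hA : A.Bireversible)
    (hT : A.LevelTransitive hA.invertible) (hX : Nat.card X = 2)
    {Γ : Type*} [Group Γ] {σ : S → Γ} {ξ : X → Γ}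
    (rel : ∀ s x, σ s * ξ x = ξ (A.step (s, x)).1 * σ (A.step (s, x)).2)
    (inj : Function.Injective (FreeGroup.lift ξ)) : ¬ Group.ResiduallyFinite Γ := by
  intro hRF
  obtain ⟨x₀, x₁, hne, huniv⟩ := Nat.card_eq_two_iff.1 hX
  have hX' : ∀ x, x = x₀ ∨ x = x₁ := fun x => by
    simpa using (huniv.symm ▸ Set.mem_univ x : x ∈ ({x₀, x₁} : Set X))
  obtain ⟨N, hN, hnorm⟩ := hA.exists_pow_normalized hne hX'
  set b := ξ x₀ * ξ x₀ * (ξ x₁)⁻¹ * (ξ x₀)⁻¹ with hb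
  set C := (ξ x₀ * (ξ x₁)⁻¹) ^ N with hC
  have hcomm : b ^ 2 * C ≠ C * b ^ 2 := by
    intro h
    refine FreeGroup.sq_conj_mul_pow_ne hne hN (inj ?_)
    simpa [hb, hC] using h
  obtain ⟨H, hH⟩ := Group.exists_finiteIndexNormalSubgroup_notMem
    ((b ^ 2 * C)⁻¹ * (C * b ^ 2)) (fun h => hcomm (inv_mul_eq_one.1 h))
  apply hH
  let p : Γ →* Γ ⧸ H.toSubgroup := QuotientGroup.mk' H.toSubgroup
  let D := p C
  let P : Subgroup (Γ ⧸ H.toSubgroup) :=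
    { carrier := {q | q * D * q⁻¹ = D ∨ q * D * q⁻¹ = D⁻¹}
      one_mem' := by simp
      mul_mem' := by
        rintro q r hq hr
        have e : q * r * D * (q * r)⁻¹ = q * (r * D * r⁻¹) * q⁻¹ := by group
        have e' : q * D⁻¹ * q⁻¹ = (q * D * q⁻¹)⁻¹ := by group
        simp only [Set.mem_ofPred_eq, e]
        rcases hq with hq | hq <;> rcases hr with hr | hr <;> rw [hr] <;> simp [e', hq]
      inv_mem' := by
        rintro q hq
        simp only [Set.mem_ofPred_eq, inv_inv]
        rcases hq with hq | hq
        · left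
          nth_rw 1 [← hq]
          group
        · right
          have : D⁻¹⁻¹ = (q * D * q⁻¹)⁻¹ := by rw [hq]
          rw [inv_inv] at this
          nth_rw 1 [this]
          group }
  have hσ : ∀ s, p (σ s) ∈ P := by
    intro s
    rcases hnorm Γ σ ξ rel s with h | h
    · left
      rw [mul_inv_eq_iff_eq_mul, ← map_mul, ← map_mul, h]
    · right
      rw [mul_inv_eq_iff_eq_mul, ← map_mul, ← map_inv, ← map_mul, h]
  have rel' : ∀ s x, p (σ s) * p (ξ x) =
      p (ξ (A.step (s, x)).1) * p (σ (A.step (s, x)).2) := fun s x => by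
    rw [← map_mul, rel, map_mul]
  -- The length `n + 2 + n` is twice the order of the quotient: a multiple of that order, so x₀ to
  -- this power is trivial, and at least 2, so there is a second letter to vary.
  let n := Nat.card (Γ ⧸ H.toSubgroup) - 1
  have hword : ∀ w : List X, w.length = n + 2 + n → (w.map (p ∘ ξ)).prod ∈ P := by
    intro w hw
    obtain ⟨g, rfl⟩ := hT (List.replicate (n + 2 + n) x₀) w (by simp [hw])
    refine (prod_map_mem_iff (σ := p ∘ σ) (ξ := p ∘ ξ) rel' hA.invertible P hσ g _).2 ?_
    have hn : n + 2 + n = Nat.card (Γ ⧸ H.toSubgroup) * 2 := by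
      have : 0 < Nat.card (Γ ⧸ H.toSubgroup) := Nat.card_pos
      omega
    rw [List.map_replicate, List.prod_replicate, hn, pow_mul, pow_card_eq_one']
    simp
  have h0 := hword (x₀ :: x₀ :: List.replicate (n + n) x₀) (by simp; omega)
  have h1 := hword (x₀ :: x₁ :: List.replicate (n + n) x₀) (by simp; omega)
  -- The common tails of the two words cancel in their quotient, which leaves b.
  have hbP : p b ∈ P := by
    have := P.mul_mem h0 (P.inv_mem h1)
    simp only [List.map_cons, List.prod_cons, Function.comp_apply] at this
    convert this using 1
    rw [hb]
    simp only [map_mul, map_inv]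
    group
  -- An element that centralizes or inverts `D` has a square that centralizes it.
  have hb2 : p b * p b * D = D * (p b * p b) := by
    have e : p b * (p b * D * (p b)⁻¹) * (p b)⁻¹ = D := by
      rcases hbP with h | h
      · rw [h, h]
      · rw [h]
        have : p b * D⁻¹ * (p b)⁻¹ = (p b * D * (p b)⁻¹)⁻¹ := by group
        rw [this, h, inv_inv]
    nth_rw 2 [← e]
    group
  change _ ∈ H.toSubgroup
  rw [← QuotientGroup.eq]
  change p _ = p _
  rw [map_mul, map_mul, map_pow, pow_two]
  exact hb2

end MealyAutomaton
-- Presentation of the fundamental group of the square complex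
section

open CategoryTheory

namespace MealyAutomaton

variable {S X : Type*} (A : MealyAutomaton S X)

/-- The class of an edge path in the fundamental group of the square complex. -/
def piClass (p : Quiver.Path (V := Quiver.Symmetrify (Bouquet S X)) .pt .pt) : A.PiOne :=
  (CategoryTheory.Quotient.functor A.squareComplex.CellHomotopy).map (SquareComplex.pathClass p)

theorem piClass_comp (p q : Quiver.Path (V := Quiver.Symmetrify (Bouquet S X)) .pt .pt) :
    A.piClass (p.comp q) = A.piClass p * A.piClass q := by
  exact (CategoryTheory.Quotient.functor A.squareComplex.CellHomotopy).map_comp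
    (SquareComplex.pathClass p) (SquareComplex.pathClass q)

theorem piClass_neg (e : (Bouquet.pt : Bouquet S X) ⟶ .pt) :
    A.piClass (Quiver.Path.nil.cons e.toNeg) = (A.piClass (Quiver.Path.nil.cons e.toPos))⁻¹ := rfl

/-- The element of the fundamental group given by the loop of a state. -/
def piVert (s : S) : A.PiOne := A.piClass (Quiver.Path.nil.cons (Bouquet.vert s).toPos)

/-- The element of the fundamental group given by the loop of a letter. -/
def piHoriz (x : X) : A.PiOne := A.piClass (Quiver.Path.nil.cons (Bouquet.horiz x).toPos)

theorem piVert_mul_piHoriz (s : S) (x : X) :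
    A.piVert s * A.piHoriz x =
      A.piHoriz (A.step (s, x)).1 * A.piVert (A.step (s, x)).2 := by
  have h : A.piClass (A.squareComplex.bdry (s, x)) = 1 := by
    refine (CategoryTheory.Quotient.sound _
      (SquareComplex.CellHomotopy.square (K := A.squareComplex) (s, x))).trans ?_
    exact (CategoryTheory.Quotient.functor A.squareComplex.CellHomotopy).map_id _
  have e : A.squareComplex.bdry (s, x) =
      (((Quiver.Path.nil.cons (Bouquet.vert s).toPos).comp
        (Quiver.Path.nil.cons (Bouquet.horiz x).toPos)).comp
        (Quiver.Path.nil.cons (Bouquet.vert (A.step (s, x)).2).toNeg)).comp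
        (Quiver.Path.nil.cons (Bouquet.horiz (A.step (s, x)).1).toNeg) := rfl
  rw [e, piClass_comp, piClass_comp, piClass_comp, piClass_neg, piClass_neg,
    mul_inv_eq_one, mul_inv_eq_iff_eq_mul] at h
  exact h

section Lift

variable {M : Type*} [Group M] (f : S → M) (g : X → M)

/-- The functor from the free groupoid on the bouquet to a group that is given by the images of the
loops. -/
def freeGroupoidLift : Quiver.FreeGroupoid (Bouquet S X) ⥤ SingleObj Mᵐᵒᵖ :=
  -- Composition in `SingleObj` reverses the product, whereas loops multiply by concatenation; hence
  -- the opposite group.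
  Quiver.FreeGroupoid.lift
    { obj := fun _ => SingleObj.star _
      map := fun e => (MulOpposite.op (Sum.elim f g e) : Mᵐᵒᵖ) }

variable {f g}

/-- The functor from the edge path groupoid of the square complex to a group in which the defining
relations hold. -/
def edgePathLift (rel : ∀ s x, f s * g x = g (A.step (s, x)).1 * f (A.step (s, x)).2) :
    A.squareComplex.EdgePathGroupoid ⥤ SingleObj Mᵐᵒᵖ :=
  CategoryTheory.Quotient.lift _ (freeGroupoidLift f g) (by
    rintro _ _ _ _ ⟨s, x⟩
    refine Eq.trans ?_ ((freeGroupoidLift f g).map_id _).symm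
    change (MulOpposite.op (g (A.step (s, x)).1))⁻¹ * ((MulOpposite.op (f (A.step (s, x)).2))⁻¹ *
      (MulOpposite.op (g x) * (MulOpposite.op (f s) * 1))) = 1
    rw [mul_one, ← MulOpposite.op_mul, rel]
    simp)

/-- The universal property of the fundamental group of the square complex. -/
def piLift (rel : ∀ s x, f s * g x = g (A.step (s, x)).1 * f (A.step (s, x)).2) :
    A.PiOne →* M where
  toFun p := MulOpposite.unop ((A.edgePathLift rel).map p : Mᵐᵒᵖ)
  map_one' := congrArg MulOpposite.unop ((A.edgePathLift rel).map_id _)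
  map_mul' p q := congrArg MulOpposite.unop ((A.edgePathLift rel).map_comp p q)

theorem piLift_piVert (rel : ∀ s x, f s * g x = g (A.step (s, x)).1 * f (A.step (s, x)).2)
    (s : S) : A.piLift rel (A.piVert s) = f s := by
  change MulOpposite.unop (MulOpposite.op (f s) * 1) = f s
  simp

theorem piLift_piHoriz (rel : ∀ s x, f s * g x = g (A.step (s, x)).1 * f (A.step (s, x)).2)
    (x : X) : A.piLift rel (A.piHoriz x) = g x := by
  change MulOpposite.unop (MulOpposite.op (g x) * 1) = g x
  simp

end Lift

end MealyAutomaton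

end

/-! ### Freeness of the letters and of the states, and duality -/

namespace MealyAutomaton

variable {S X : Type*} {A : MealyAutomaton S X}

namespace Bireversible

/-- The permutation `(s, v) ↦ (t, v y)` for an arrow `s --x|y--> t`. -/
noncomputable def transducePerm (h : A.Bireversible) (x : X) : Equiv.Perm (S × FreeGroup X) :=
  -- The output letter is recovered from the target state, so the map is a composite of evident
  -- bijections.
  ((h.next x).prodCongr (Equiv.refl _)).trans
    ((Equiv.refl S).prodShear fun t =>
      Equiv.mulRight (FreeGroup.of (A.step ((h.next x).symm t, x)).1))

theorem transducePerm_apply (h : A.Bireversible) (x : X) (s : S) (v : FreeGroup X) :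
    h.transducePerm x (s, v) =
      ((A.step (s, x)).2, v * FreeGroup.of (A.step (s, x)).1) := by
  have : (h.next x).symm (h.next x s) = s := Equiv.symm_apply_apply _ _
  rw [← h.next_apply]
  simp [transducePerm, this]

/-- Reading a reduced word, letter after letter from the left, and writing the output. -/
noncomputable def transduce (h : A.Bireversible) :
    FreeGroup X →* (Equiv.Perm (S × FreeGroup X))ᵐᵒᵖ :=
  FreeGroup.lift fun x => MulOpposite.op (h.transducePerm x)

/-- The state reached from `s` and the output, for a reduced word. -/
noncomputable def run (h : A.Bireversible) (p : S × FreeGroup X) (v : FreeGroup X) :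
    S × FreeGroup X :=
  (h.transduce v).unop p

theorem run_one (h : A.Bireversible) (p : S × FreeGroup X) : h.run p 1 = p := by
  simp [run]

theorem run_mul (h : A.Bireversible) (p : S × FreeGroup X) (v w : FreeGroup X) :
    h.run p (v * w) = h.run (h.run p v) w := by
  simp [run]

theorem run_of (h : A.Bireversible) (s : S) (v : FreeGroup X) (x : X) :
    h.run (s, v) (FreeGroup.of x) = ((A.step (s, x)).2, v * FreeGroup.of (A.step (s, x)).1) := by
  simp [run, transduce, transducePerm_apply]

theorem run_of_inv (h : A.Bireversible) (s : S) (v : FreeGroup X) (x : X) :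
    h.run ((A.step (s, x)).2, v) (FreeGroup.of x)⁻¹ =
      (s, v * (FreeGroup.of (A.step (s, x)).1)⁻¹) := by
  have : ((A.step (s, x)).2, v) =
      h.run (s, v * (FreeGroup.of (A.step (s, x)).1)⁻¹) (FreeGroup.of x) := by
    rw [run_of, inv_mul_cancel_right]
  rw [this, ← run_mul, mul_inv_cancel, run_one]

theorem run_mul_left (h : A.Bireversible) (s : S) (u v w : FreeGroup X) :
    h.run (s, u * v) w = ((h.run (s, v) w).1, u * (h.run (s, v) w).2) := by
  induction w using FreeGroup.induction_on generalizing s v with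
  | C1 => simp [run_one]
  | of x => simp [run_of, mul_assoc]
  | inv_of x _ =>
    obtain ⟨t, rfl⟩ := (h.next_bijective x).2 s
    simp [run_of_inv, mul_assoc]
  | mul a b ha hb => rw [run_mul, run_mul, ha, hb]

/-- The inverse automaton. -/
noncomputable def inv (h : A.Bireversible) : MealyAutomaton S X where
  step p := (h.i p.1 p.2).choose

theorem inv_step (h : A.Bireversible) (s : S) (x : X) :
    h.inv.step (s, (A.step (s, x)).1) = (x, (A.step (s, x)).2) :=
  ((h.i s (A.step (s, x)).1).choose_spec.2 (x, (A.step (s, x)).2) rfl).symm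

theorem step_inv (h : A.Bireversible) (s : S) (y : X) :
    A.step (s, (h.inv.step (s, y)).1) = (y, (h.inv.step (s, y)).2) :=
  (h.i s y).choose_spec.1

theorem inv_arrows (h : A.Bireversible) : h.inv.arrows = A.arrows.inverse := by
  funext s y x t
  refine propext ⟨fun hs => ?_, fun hs => ?_⟩
  · have hs' : h.inv.step (s, y) = (x, t) := hs
    have := h.step_inv s y
    rwa [hs'] at this
  · have hs' : A.step (s, x) = (y, t) := hs
    have := h.inv_step s x
    rwa [hs'] at this

theorem inv_bireversible (h : A.Bireversible) : h.inv.Bireversible := by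
  constructor <;> rw [inv_arrows]
  · exact h.i
  · exact h.di
  · exact h.self
  · exact h.idi
  · exact h.d
  · exact h.idid
  · exact h.id
  · exact h.did

/-- The inverse automaton follows the same states with input and output exchanged, also on inverse
letters. This gives the injectivity of `out`. -/
theorem run_inv_run (h : A.Bireversible) (s : S) (w : FreeGroup X) :
    h.inv_bireversible.run (s, 1) (h.run (s, 1) w).2 = ((h.run (s, 1) w).1, w) := by
  induction w using FreeGroup.induction_on generalizing s with
  | C1 => simp [run_one]
  | of x => simp [run_of, inv_step]
  | inv_of x _ =>
    obtain ⟨s, rfl⟩ := (h.next_bijective x).2 s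
    have := h.inv_bireversible.run_of_inv s 1 (A.step (s, x)).1
    simpa [run_of_inv, inv_step] using this
  | mul a b ha hb =>
    obtain ⟨⟨t, a'⟩, hta⟩ : ∃ p, h.run (s, 1) a = p := ⟨_, rfl⟩
    have h1 := ha s
    have h2 := h.run_mul_left t a' 1 b
    have h3 := h.inv_bireversible.run_mul_left t a 1 (h.run (t, 1) b).2
    rw [hta] at h1
    rw [mul_one] at h2 h3
    rw [run_mul, hta, h2]
    dsimp only at h1 ⊢
    rw [run_mul, h1, h3, hb]

/-- The action of a state on reduced words. -/
noncomputable def out (h : A.Bireversible) (s : S) (w : FreeGroup X) : FreeGroup X :=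
  (h.run (s, 1) w).2

theorem out_of_mul (h : A.Bireversible) (s : S) (x : X) (w : FreeGroup X) :
    h.out s (FreeGroup.of x * w) =
      FreeGroup.of (A.step (s, x)).1 * h.out (A.step (s, x)).2 w := by
  have := h.run_mul_left (A.step (s, x)).2 (FreeGroup.of (A.step (s, x)).1) 1 w
  rw [mul_one] at this
  rw [out, run_mul, run_of, one_mul, this, out]

theorem exists_out_eq (h : A.Bireversible) (s : S) (w : FreeGroup X) : ∃ v, h.out s v = w := by
  induction w using FreeGroup.induction_on generalizing s with
  | C1 => exact ⟨1, by simp [out, run_one]⟩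
  | of y => exact ⟨FreeGroup.of (h.inv.step (s, y)).1, by simp [out, run_of, step_inv]⟩
  | inv_of y _ =>
    -- To write y⁻¹ from `s`, traverse backwards the arrow with output y and target `s`.
    obtain ⟨s', x, hs⟩ := h.exists_step_eq y s
    have := h.run_of_inv s' 1 x
    rw [hs] at this
    exact ⟨(FreeGroup.of x)⁻¹, by simp [out, this]⟩
  | mul a b ha hb =>
    obtain ⟨v, hv⟩ := ha s
    obtain ⟨w, hw⟩ := hb (h.run (s, 1) v).1
    refine ⟨v * w, ?_⟩
    have h2 := h.run_mul_left (h.run (s, 1) v).1 (h.run (s, 1) v).2 1 w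
    rw [mul_one] at h2
    rw [out] at hv hw ⊢
    rw [run_mul, ← hv, ← hw]
    exact congrArg Prod.snd h2

theorem out_bijective (h : A.Bireversible) (s : S) : Function.Bijective (h.out s) := by
  refine ⟨fun v w hvw => ?_, h.exists_out_eq s⟩
  have hv := congrArg Prod.snd (h.run_inv_run s v)
  have hw := congrArg Prod.snd (h.run_inv_run s w)
  rw [out, out] at hvw
  rw [hvw] at hv
  exact hv.symm.trans hw

/-- The permutation of the reduced words defined by a state. -/
noncomputable def outPerm (h : A.Bireversible) (s : S) : Equiv.Perm (FreeGroup X) :=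
  Equiv.ofBijective _ (h.out_bijective s)

theorem outPerm_mul (h : A.Bireversible) (s : S) (x : X) :
    h.outPerm s * MulAction.toPermHom _ _ (FreeGroup.of x) =
      MulAction.toPermHom _ _ (FreeGroup.of (A.step (s, x)).1) *
        h.outPerm (A.step (s, x)).2 :=
  Equiv.ext fun w => h.out_of_mul s x w

/-- The group acts on reduced words, states by `outPerm` and letters by left multiplication; on the
letters this is the faithful regular action. -/
theorem lift_piHoriz_injective (h : A.Bireversible) :
    Function.Injective (FreeGroup.lift A.piHoriz) := by
  let ψ := A.piLift h.outPerm_mul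
  have key : ∀ w, ψ (FreeGroup.lift A.piHoriz w) =
      MulAction.toPermHom (FreeGroup X) (FreeGroup X) w := by
    intro w
    rw [← MonoidHom.comp_apply]
    congr 1
    ext1 x
    simp [ψ, piLift_piHoriz]
  intro v w hvw
  have := congrArg ψ hvw
  rw [key, key] at this
  exact MulAction.toPerm_injective this

end Bireversible

/-- The dual automaton. -/
def dual (A : MealyAutomaton S X) : MealyAutomaton X S where
  step p := (A.step p.swap).swap

theorem dual_arrows (A : MealyAutomaton S X) : A.dual.arrows = A.arrows.dual := by
  funext x s t y
  exact propext (Prod.swap_injective.eq_iff (a := A.step (s, x)) (b := (y, t)))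

theorem Bireversible.dual_bireversible (h : A.Bireversible) : A.dual.Bireversible := by
  constructor <;> rw [dual_arrows]
  · exact h.d
  · exact h.self
  · exact h.id
  · exact h.i
  · exact h.did
  · exact h.di
  · exact h.idid
  · exact h.idi

/-- Inverting sx = yt gives x⁻¹s⁻¹ = t⁻¹y⁻¹, the square relation of the dual. So the inverse
generators satisfy the relations of the dual inside the same group. -/
theorem inv_piHoriz_mul (A : MealyAutomaton S X) (x : X) (s : S) :
    (A.piHoriz x)⁻¹ * (A.piVert s)⁻¹ =
      (A.piVert (A.dual.step (x, s)).1)⁻¹ * (A.piHoriz (A.dual.step (x, s)).2)⁻¹ := by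
  rw [← mul_inv_rev, ← mul_inv_rev, piVert_mul_piHoriz]
  rfl

theorem Bireversible.lift_inv_piVert_injective (h : A.Bireversible) :
    Function.Injective (FreeGroup.lift fun s => (A.piVert s)⁻¹) := by
  have rel : ∀ s x, (MulAction.toPermHom (FreeGroup S) (FreeGroup S) (FreeGroup.of s))⁻¹ *
      (h.dual_bireversible.outPerm x)⁻¹ = (h.dual_bireversible.outPerm (A.step (s, x)).1)⁻¹ *
        (MulAction.toPermHom _ _ (FreeGroup.of (A.step (s, x)).2))⁻¹ := by
    intro s x
    rw [← mul_inv_rev, ← mul_inv_rev, h.dual_bireversible.outPerm_mul x s]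
    rfl
  let ψ := A.piLift rel
  have key : ∀ w, ψ (FreeGroup.lift (fun s => (A.piVert s)⁻¹) w) =
      MulAction.toPermHom (FreeGroup S) (FreeGroup S) w := by
    intro w
    rw [← MonoidHom.comp_apply]
    congr 1
    ext1 x
    simp [ψ, piLift_piVert]
  intro v w hvw
  have := congrArg ψ hvw
  rw [key, key] at this
  exact MulAction.toPerm_injective this

theorem LevelTransitive.not_residuallyFinite_piOne [Finite S] (hA : A.Bireversible)
    (hT : A.LevelTransitive hA.invertible) (hX : Nat.card X = 2) :
    ¬ Group.ResiduallyFinite A.PiOne :=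
  hT.not_residuallyFinite hA hX A.piVert_mul_piHoriz hA.lift_piHoriz_injective

theorem LevelTransitive.not_residuallyFinite_piOne_of_dual [Finite X] (hA : A.Bireversible)
    (hT : A.dual.LevelTransitive hA.dual_bireversible.invertible) (hS : Nat.card S = 2) :
    ¬ Group.ResiduallyFinite A.PiOne :=
  hT.not_residuallyFinite hA.dual_bireversible hS (σ := fun x => (A.piHoriz x)⁻¹)
    A.inv_piHoriz_mul hA.lift_inv_piVert_injective

end MealyAutomaton
-- Infinite automaton groups over two letters are level transitive
namespace MealyAutomaton

variable {S X : Type*} {A : MealyAutomaton S X}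

theorem freeAction_of (h : A.Invertible) (s : S) (w : List X) :
    A.freeAction h (FreeGroup.of s) w = A.act s w := by
  simp [freeAction, actPerm]

theorem freeAction_inv_apply (h : A.Invertible) (g : FreeGroup S) (w : List X) :
    A.freeAction h g⁻¹ (A.freeAction h g w) = w := by
  rw [← Equiv.Perm.mul_apply, ← map_mul, inv_mul_cancel, map_one, Equiv.Perm.one_apply]

theorem freeAction_apply_inv (h : A.Invertible) (g : FreeGroup S) (w : List X) :
    A.freeAction h g (A.freeAction h g⁻¹ w) = w := by
  rw [← Equiv.Perm.mul_apply, ← map_mul, mul_inv_cancel, map_one, Equiv.Perm.one_apply]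

theorem act_length (s : S) (w : List X) : (A.act s w).length = w.length := by
  induction w generalizing s with
  | nil => rfl
  | cons x w ih => simp [act, ih]

theorem freeAction_length (h : A.Invertible) (g : FreeGroup S) (w : List X) :
    (A.freeAction h g w).length = w.length := by
  induction g using FreeGroup.induction_on generalizing w with
  | C1 => simp
  | of s => rw [freeAction_of, act_length]
  | inv_of s ih =>
    rw [← ih, freeAction_apply_inv]
  | mul a b ha hb => rw [map_mul, Equiv.Perm.mul_apply, ha, hb]

/-- Self-similarity of the action. -/
theorem freeAction_append (h : A.Invertible) (g : FreeGroup S) (u : List X) :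
    ∃ g' : FreeGroup S, ∀ w, A.freeAction h g (u ++ w) =
      A.freeAction h g u ++ A.freeAction h g' w := by
  induction g using FreeGroup.induction_on generalizing u with
  | C1 => exact ⟨1, by simp⟩
  | of s =>
    induction u generalizing s with
    | nil => exact ⟨.of s, by simp [freeAction_of, act]⟩
    | cons x u ih =>
      obtain ⟨g', hg'⟩ := ih (A.step (s, x)).2
      refine ⟨g', fun w => ?_⟩
      have := hg' w
      simp only [freeAction_of] at this
      simp [freeAction_of, act, this]
  | inv_of s ih =>
    obtain ⟨g', hg'⟩ := ih (A.freeAction h (.of s)⁻¹ u)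
    refine ⟨g'⁻¹, fun w => ?_⟩
    have := hg' (A.freeAction h g'⁻¹ w)
    rw [freeAction_apply_inv, freeAction_apply_inv] at this
    rw [← this, freeAction_inv_apply]
  | mul a b ha hb =>
    obtain ⟨b', hb'⟩ := hb u
    obtain ⟨a', ha'⟩ := ha (A.freeAction h b u)
    exact ⟨a' * b', fun w => by simp [hb', ha']⟩

theorem freeAction_prefix (h : A.Invertible) (g : FreeGroup S) {u w : List X}
    (hg : A.freeAction h g (u ++ w) = u ++ w) : A.freeAction h g u = u := by
  obtain ⟨g', hg'⟩ := A.freeAction_append h g u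
  rw [hg'] at hg
  exact List.append_inj_left hg (A.freeAction_length h g u)

theorem finite_automatonGroup_of_faithful [Finite X] (h : A.Invertible) (n : ℕ)
    (hn : ∀ g, (∀ w : List X, w.length = n → A.freeAction h g w = w) → A.freeAction h g = 1) :
    Finite (A.AutomatonGroup h) := by
  let W := {w : List X // w.length = n}
  have : Finite W := List.finite_length_eq X n
  let f : A.AutomatonGroup h → (W → W) := fun q w =>
    ⟨QuotientGroup.kerLift (A.freeAction h) q w.1, by
      induction q using QuotientGroup.induction_on
      rw [QuotientGroup.kerLift_mk, freeAction_length, w.2]⟩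
  refine Finite.of_injective f fun p q hpq => ?_
  induction p using QuotientGroup.induction_on with | H a => ?_
  induction q using QuotientGroup.induction_on with | H b => ?_
  rw [QuotientGroup.eq, MonoidHom.mem_ker]
  refine hn _ fun w hw => ?_
  have : A.freeAction h a w = A.freeAction h b w :=
    congrArg Subtype.val (congrFun hpq ⟨w, hw⟩)
  rw [map_mul, Equiv.Perm.mul_apply, ← this, freeAction_inv_apply]

/-- Over a two-letter alphabet, the automaton group is finite unless it acts transitively on all
levels. -/
theorem levelTransitive_of_infinite (h : A.Invertible) (hX : Nat.card X = 2)
    (hinf : Infinite (A.AutomatonGroup h)) : A.LevelTransitive h := by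
  have : Finite X := Nat.finite_of_card_ne_zero (by omega)
  have two : ∀ x y z : X, x ≠ y → z = x ∨ z = y := by
    obtain ⟨x₀, x₁, -, huniv⟩ := Nat.card_eq_two_iff.1 hX
    have hX' : ∀ x, x = x₀ ∨ x = x₁ := fun x => by
      simpa using (huniv.symm ▸ Set.mem_univ x : x ∈ ({x₀, x₁} : Set X))
    intro x y z hxy
    rcases hX' x with rfl | rfl <;> rcases hX' y with rfl | rfl <;>
      rcases hX' z with rfl | rfl <;> simp_all
  suffices H : ∀ n, ∀ u v : List X, u.length = n → v.length = n → ∃ g, A.freeAction h g u = v from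
    fun u v huv => H _ u v huv rfl
  intro n
  induction n with
  | zero =>
    intro u v hu hv
    exact ⟨1, by simp [List.length_eq_zero_iff.1 hu, List.length_eq_zero_iff.1 hv]⟩
  | succ n ih =>
    -- Either some element fixes a word of length `n` and exchanges its two extensions, and
    -- transitivity passes to the next level, or the action on level `n` is faithful.
    by_cases hswap : ∃ (g : FreeGroup S) (u : List X) (x y : X), u.length = n ∧ x ≠ y ∧
        A.freeAction h g (u ++ [x]) = u ++ [y]
    · obtain ⟨g, u, x, y, hu, hxy, hg⟩ := hswap
      have base : ∀ v : List X, v.length = n + 1 → ∃ k, A.freeAction h k (u ++ [x]) = v := by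
        intro v hv
        obtain ⟨v, z, rfl⟩ : ∃ v' z, v = v' ++ [z] :=
          ⟨_, _, (List.dropLast_append_getLast (by rintro rfl; simp at hv)).symm⟩
        obtain ⟨k, hk⟩ := ih u v hu (by simpa using hv)
        obtain ⟨k', hk'⟩ := A.freeAction_append h k u
        have hx := hk' [x]
        have hy := hk' [y]
        have hlen : ∀ a : X, ∃ b, A.freeAction h k' [a] = [b] := fun a =>
          List.length_eq_one_iff.1 (A.freeAction_length h k' [a])
        obtain ⟨a, ha⟩ := hlen x
        obtain ⟨b, hb⟩ := hlen y
        have hab : a ≠ b := by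
          rintro rfl
          have := (A.freeAction h k').injective (ha.trans hb.symm)
          simp [hxy] at this
        rcases two a b z hab with rfl | rfl
        · exact ⟨k, by rw [hx, hk, ha]⟩
        · exact ⟨k * g, by rw [map_mul, Equiv.Perm.mul_apply, hg, hy, hk, hb]⟩
      intro v w hv hw
      obtain ⟨k, rfl⟩ := base v hv
      obtain ⟨l, rfl⟩ := base w hw
      exact ⟨l * k⁻¹, by rw [map_mul, Equiv.Perm.mul_apply, freeAction_inv_apply]⟩
    · push Not at hswap
      refine absurd hinf (not_infinite_iff_finite.2
        (A.finite_automatonGroup_of_faithful h n fun g hg => ?_))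
      -- A sliding window of length `n`: a fixed window forces the next letter to be fixed. Dropping
      -- the first letter z, the section at z fixes the shifted window `v`, and the induction
      -- continues with that section.
      have fix : ∀ (m : ℕ) (g : FreeGroup S) (u w : List X), w.length = m → u.length = n →
          A.freeAction h g u = u → A.freeAction h g (u ++ w) = u ++ w := by
        intro m
        induction m with
        | zero =>
          intro g u w hw _ hg
          rw [List.length_eq_zero_iff.1 hw, List.append_nil, hg]
        | succ m ihm =>
          intro g u w hw hu hg
          obtain ⟨x, w, rfl⟩ := List.exists_cons_of_length_eq_add_one hw
          obtain ⟨g', hg'⟩ := A.freeAction_append h g u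
          obtain ⟨y, hy⟩ := List.length_eq_one_iff.1 (A.freeAction_length h g' [x])
          have hux : A.freeAction h g (u ++ [x]) = u ++ [x] := by
            by_cases hxy : x = y
            · rw [hg', hy, hg, hxy]
            · exact absurd (by rw [hg', hy, hg]) (hswap g u x y hu hxy)
          obtain ⟨z, v, hzv⟩ := List.exists_cons_of_length_eq_add_one
            (show (u ++ [x]).length = n + 1 by simp [hu])
          have hv : v.length = n := by
            have := congrArg List.length hzv
            simp [hu] at this
            exact this.symm
          obtain ⟨k, hk⟩ := A.freeAction_append h g [z]
          have hz : A.freeAction h g [z] = [z] :=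
            A.freeAction_prefix h g (w := v) (by simpa [← hzv] using hux)
          have hkv : A.freeAction h k v = v := by
            have := hk v
            rw [hz, List.singleton_append, ← hzv, hux, hzv] at this
            simpa using this.symm
          have e : u ++ x :: w = [z] ++ (v ++ w) := by
            rw [← List.append_assoc, List.singleton_append, ← hzv]
            simp
          rw [e, hk, hz, ihm k v w (by simpa using hw) hv hkv]
      ext1 w
      rw [Equiv.Perm.one_apply]
      rcases le_total w.length n with hw | hw
      · by_cases hne : Nonempty X
        · obtain ⟨x⟩ := hne
          exact A.freeAction_prefix h g (w := List.replicate (n - w.length) x)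
            (hg _ (by simp; omega))
        · have := not_nonempty_iff.1 hne
          simp at hX
      · rw [← List.take_append_drop n w]
        exact fix _ g _ _ rfl (by simpa using hw) (hg _ (by simpa using hw))

/-! ### Finiteness passes from the dual group to the automaton group -/

section DualFinite

/-- The composition of the actions of a sequence of states, the first one acting first. -/
def actList (A : MealyAutomaton S X) : List S → List X → List X
  | [], w => w
  | s :: l, w => actList A l (A.act s w)

/-- The composition of the outputs of a sequence of states for a letter, the first one acting
first. -/
def outList (A : MealyAutomaton S X) : List S → X → X
  | [], x => x
  | s :: l, x => outList A l (A.step (s, x)).1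

theorem actList_nil (l : List S) : A.actList l [] = [] := by
  induction l with
  | nil => rfl
  | cons s l ih => simp [actList, act, ih]

theorem actList_cons (l : List S) (x : X) (w : List X) :
    A.actList l (x :: w) = A.outList l x :: A.actList (A.dual.act x l) w := by
  induction l generalizing x w with
  | nil => rfl
  | cons s l ih => simp [actList, outList, act, ih, dual]

theorem actList_append (l m : List S) (w : List X) :
    A.actList (l ++ m) w = A.actList m (A.actList l w) := by
  induction l generalizing w with
  | nil => rfl
  | cons s l ih => simp [actList, ih]

theorem finite_range_actList [Finite X] (hd : A.dual.Invertible)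
    [Finite (A.dual.AutomatonGroup hd)] : (Set.range A.actList).Finite := by
  let R := (A.dual.freeAction hd).range
  have : Finite R := Finite.of_equiv _ (QuotientGroup.quotientKerEquivRange _).toEquiv
  -- `F l` records the one-letter outputs along the whole dual orbit of `l`. Reading a letter x
  -- translates the argument `r` by x, so by `actList_cons` this finite datum determines the action
  -- of `l` on all words.
  let F : List S → R → X → X := fun l r => A.outList (r.1 l)
  have hF : ∀ (w : List X) (l m : List S), F l = F m → A.actList l w = A.actList m w := by
    intro w
    induction w with
    | nil => intro l m _; rw [actList_nil, actList_nil]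
    | cons x w ih =>
      intro l m hlm
      have h1 : A.outList l = A.outList m := congrFun hlm 1
      rw [actList_cons, actList_cons, h1]
      congr 1
      refine ih _ _ (funext fun r => ?_)
      have := congrFun hlm (r * ⟨A.dual.freeAction hd (.of x), .of x, rfl⟩)
      simpa [F, freeAction_of] using this
  have : (Set.range F).Finite := Set.toFinite _
  refine (this.image fun φ => A.actList (Function.invFun F φ)).subset ?_
  rintro _ ⟨l, rfl⟩
  refine ⟨F l, ⟨l, rfl⟩, funext fun w => hF w _ _ ?_⟩
  exact Function.invFun_eq ⟨l, rfl⟩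

/-- The monoid generated by the states is finite by `finite_range_actList`, and a finite submonoid
of a group is closed under inverses. -/
theorem finite_automatonGroup_of_dual [Finite X] (h : A.Invertible) (hd : A.dual.Invertible)
    [Finite (A.dual.AutomatonGroup hd)] : Finite (A.AutomatonGroup h) := by
  have hfin := A.finite_range_actList hd
  let M : Submonoid (Equiv.Perm (List X)) :=
    { carrier := {p | ∃ l, ⇑p = A.actList l}
      one_mem' := ⟨[], rfl⟩
      mul_mem' := by
        rintro p q ⟨l, hl⟩ ⟨m, hm⟩
        exact ⟨m ++ l, funext fun w => by rw [actList_append, Equiv.Perm.mul_apply, hl, hm]⟩ }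
  have : Finite M := by
    have := hfin.to_subtype
    refine Finite.of_injective
      (fun p : M => (⟨p.1, let ⟨l, hl⟩ := p.2; ⟨l, hl.symm⟩⟩ : Set.range A.actList))
      fun p q hpq => ?_
    exact Subtype.ext (DFunLike.coe_injective (congrArg Subtype.val hpq))
  have hinv : ∀ p ∈ M, p⁻¹ ∈ M := by
    intro p hp
    have hf : IsOfFinOrder p := finite_powers.1
      ((Set.toFinite (M : Set (Equiv.Perm (List X)))).subset (Submonoid.powers_le.2 hp))
    have := hf.mem_powers_iff_mem_zpowers.2 (Subgroup.inv_mem _ (Subgroup.mem_zpowers p))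
    obtain ⟨k, hk⟩ := this
    exact hk ▸ M.pow_mem hp k
  have hM : ∀ g, A.freeAction h g ∈ M := by
    intro g
    induction g using FreeGroup.induction_on with
    | C1 => rw [map_one]; exact M.one_mem
    | of s => exact ⟨[s], funext fun w => freeAction_of h s w⟩
    | inv_of s ih => rw [map_inv]; exact hinv _ ih
    | mul a b ha hb => rw [map_mul]; exact M.mul_mem ha hb
  have : Finite (A.freeAction h).range :=
    ((Set.toFinite (M : Set (Equiv.Perm (List X)))).subset
      (by rintro _ ⟨g, rfl⟩; exact hM g)).to_subtype
  exact Finite.of_equiv _ (QuotientGroup.quotientKerEquivRange (A.freeAction h)).symm.toEquiv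

end DualFinite

end MealyAutomaton
-- A parity criterion for level transitivity
namespace MealyAutomaton

/-- The sum of a function over the binary words of length `n`. -/
def wordSum : ℕ → (List (Fin 2) → ZMod 2) → ZMod 2
  | 0, F => F []
  | n + 1, F => wordSum n (fun w => F (0 :: w)) + wordSum n (fun w => F (1 :: w))

theorem wordSum_add (n : ℕ) (F G : List (Fin 2) → ZMod 2) :
    wordSum n (fun w => F w + G w) = wordSum n F + wordSum n G := by
  induction n generalizing F G with
  | zero => rfl
  | succ n ih => simp only [wordSum, ih]; ring

theorem wordSum_congr {n : ℕ} {F G : List (Fin 2) → ZMod 2}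
    (h : ∀ w, w.length = n → F w = G w) : wordSum n F = wordSum n G := by
  induction n generalizing F G with
  | zero => exact h [] rfl
  | succ n ih =>
    simp only [wordSum]
    rw [ih fun w hw => h (0 :: w) (by simp [hw]), ih fun w hw => h (1 :: w) (by simp [hw])]

variable {S : Type*} {A : MealyAutomaton S (Fin 2)}

/-- A state permutes the words of length `n`, so it only reorders the sum. -/
theorem wordSum_act (h : A.Invertible) (n : ℕ) (s : S) (F : List (Fin 2) → ZMod 2) :
    wordSum n (fun w => F (A.act s w)) = wordSum n F := by
  induction n generalizing s F with
  | zero => rfl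
  | succ n ih =>
    simp only [wordSum, act]
    rw [ih _ fun w => F ((A.step (s, 0)).1 :: w), ih _ fun w => F ((A.step (s, 1)).1 :: w)]
    have hne : (A.step (s, 0)).1 ≠ (A.step (s, 1)).1 := by
      intro e
      have := (A.act_bijective h s).1 (a₁ := [0]) (a₂ := [1]) (by simp [act, e])
      simp at this
    rcases Fin.exists_fin_two.1 ⟨(A.step (s, 0)).1, rfl⟩ with h0 | h0 <;>
      rcases Fin.exists_fin_two.1 ⟨(A.step (s, 1)).1, rfl⟩ with h1 | h1 <;>
      simp_all [add_comm]

/-- The number modulo two of the words `w` of length `n` such that the section of the state at `w`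
permutes the two letters. -/
def activity (A : MealyAutomaton S (Fin 2)) : ℕ → S → ZMod 2
  | 0, s => ((A.step (s, 0)).1.val : ZMod 2)
  | n + 1, s => A.activity n (A.step (s, 0)).2 + A.activity n (A.step (s, 1)).2

theorem activity_eq_wordSum (n : ℕ) (s : S) :
    A.activity n s = wordSum n fun w => A.activity 0 (A.sectionAt s w) := by
  induction n generalizing s with
  | zero => rfl
  | succ n ih => simp only [wordSum, sectionAt, activity, ih]

theorem act_append (s : S) (u w : List (Fin 2)) :
    A.act s (u ++ w) = A.act s u ++ A.act (A.sectionAt s u) w := by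
  induction u generalizing s with
  | nil => rfl
  | cons x u ih => simp [act, sectionAt, ih]

/-- If for each `n` some state has an odd number of active sections at level `n`, then the
automaton group acts transitively on all levels. -/
theorem levelTransitive_of_activity (h : A.Invertible) (hact : ∀ n, ∃ s, A.activity n s = 1) :
    A.LevelTransitive h := by
  classical
  suffices H : ∀ n, ∀ u v : List (Fin 2), u.length = n → v.length = n →
      ∃ g, A.freeAction h g u = v from fun u v huv => H _ u v huv rfl
  intro n
  induction n with
  | zero =>
    intro u v hu hv
    exact ⟨1, by simp [List.length_eq_zero_iff.1 hu, List.length_eq_zero_iff.1 hv]⟩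
  | succ n ih =>
    let orb : List (Fin 2) → List (Fin 2) → Prop := fun u v => ∃ g, A.freeAction h g u = v
    have orb_trans : ∀ {u v w}, orb u v → orb v w → orb u w := by
      rintro _ _ _ ⟨g, rfl⟩ ⟨k, rfl⟩
      exact ⟨k * g, by simp⟩
    have orb_symm : ∀ {u v}, orb u v → orb v u := by
      rintro _ _ ⟨g, rfl⟩
      exact ⟨g⁻¹, A.freeAction_inv_apply h g _⟩
    have orb_act : ∀ s u, orb u (A.act s u) := fun s u => ⟨.of s, freeAction_of h s u⟩
    let o : List (Fin 2) := List.replicate n 0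
    have cover : ∀ v : List (Fin 2), v.length = n → ∃ a : Fin 2, orb (v ++ [0]) (o ++ [a]) ∧
        ∃ b, a ≠ b ∧ orb (v ++ [1]) (o ++ [b]) := by
      intro v hv
      obtain ⟨k, hk⟩ := ih v o hv (by simp [o])
      obtain ⟨k', hk'⟩ := A.freeAction_append h k v
      have hlen : ∀ a : Fin 2, ∃ b, A.freeAction h k' [a] = [b] := fun a =>
        List.length_eq_one_iff.1 (A.freeAction_length h k' [a])
      obtain ⟨a, ha⟩ := hlen 0
      obtain ⟨b, hb⟩ := hlen 1
      refine ⟨a, ⟨k, by rw [hk', hk, ha]⟩, b, ?_, ⟨k, by rw [hk', hk, hb]⟩⟩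
      rintro rfl
      have := (A.freeAction h k').injective (ha.trans hb.symm)
      simp at this
    by_cases hs : orb (o ++ [0]) (o ++ [1])
    · have all : ∀ v : List (Fin 2), v.length = n + 1 → orb v (o ++ [0]) := by
        intro v hv
        obtain ⟨v, z, rfl⟩ : ∃ v' z, v = v' ++ [z] :=
          ⟨_, _, (List.dropLast_append_getLast (by rintro rfl; simp at hv)).symm⟩
        obtain ⟨a, ha, b, -, hb⟩ := cover v (by simpa using hv)
        have any : ∀ c : Fin 2, orb (o ++ [c]) (o ++ [0]) := by
          intro c
          rcases Fin.exists_fin_two.1 ⟨c, rfl⟩ with rfl | rfl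
          · exact ⟨1, by simp⟩
          · exact orb_symm hs
        rcases Fin.exists_fin_two.1 ⟨z, rfl⟩ with rfl | rfl
        · exact orb_trans ha (any a)
        · exact orb_trans hb (any b)
      intro u v hu hv
      exact orb_trans (all u hu) (orb_symm (all v hv))
    · exfalso
      -- If v0 and v1 are never in the same orbit, there are two orbits on the next level, and `F`
      -- records which of them contains v0. A state changes this value exactly when its section at
      -- `v` swaps the letters.
      let F : List (Fin 2) → ZMod 2 := fun v => if orb (v ++ [0]) (o ++ [0]) then 0 else 1
      obtain ⟨s, hsact⟩ := hact n
      have key : ∀ v : List (Fin 2), v.length = n →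
          F (A.act s v) = F v + A.activity 0 (A.sectionAt s v) := by
        intro v hv
        set t := A.sectionAt s v with ht
        have h0 := orb_act s (v ++ [0])
        have h1 := orb_act s (v ++ [1])
        rw [act_append, ← ht] at h0 h1
        simp only [act] at h0 h1
        have hne : (A.step (t, 0)).1 ≠ (A.step (t, 1)).1 := by
          intro e
          have := (A.act_bijective h t).1 (a₁ := [0]) (a₂ := [1]) (by simp [act, e])
          simp at this
        obtain ⟨a, ha, b, hab, hb⟩ := cover v hv
        have not_both : ∀ {w}, orb w (o ++ [0]) → ¬ orb w (o ++ [1]) := fun h₁ h₂ =>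
          hs (orb_trans (orb_symm h₁) h₂)
        rcases Fin.exists_fin_two.1 ⟨(A.step (t, 0)).1, rfl⟩ with e0 | e0
        · rw [e0] at h0
          have : orb (A.act s v ++ [0]) (o ++ [0]) ↔ orb (v ++ [0]) (o ++ [0]) :=
            ⟨orb_trans h0, orb_trans (orb_symm h0)⟩
          simp [F, this, activity, e0]
        · have e1 : (A.step (t, 1)).1 = 0 := by
            rcases Fin.exists_fin_two.1 ⟨(A.step (t, 1)).1, rfl⟩ with e1 | e1
            · exact e1
            · exact absurd (e0.trans e1.symm) hne
          rw [e1] at h1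
          have : orb (A.act s v ++ [0]) (o ++ [0]) ↔ ¬ orb (v ++ [0]) (o ++ [0]) := by
            rcases Fin.exists_fin_two.1 ⟨a, rfl⟩ with rfl | rfl
            · rcases Fin.exists_fin_two.1 ⟨b, rfl⟩ with rfl | rfl
              · exact absurd rfl hab
              · refine ⟨fun h' => absurd hb (not_both (orb_trans h1 h')), fun h' => absurd ha h'⟩
            · rcases Fin.exists_fin_two.1 ⟨b, rfl⟩ with rfl | rfl
              · exact ⟨fun _ h' => not_both h' ha, fun _ => orb_trans (orb_symm h1) hb⟩
              · exact absurd rfl hab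
          by_cases hv0 : orb (v ++ [0]) (o ++ [0])
          · simp [F, this, activity, e0, hv0]
          · simp only [F, this, activity, e0, hv0, not_false_eq_true, if_true, if_false]
            decide
      -- Summed over all `v`, the values of `F` cancel by invariance, so the activity of `s` would
      -- be 0.
      have hsum := wordSum_act h n s F
      rw [wordSum_congr key, wordSum_add, ← activity_eq_wordSum, hsact] at hsum
      simp at hsum

end MealyAutomaton

/-! ### The Aleshin and Bellaterra automata, and the theorem -/

instance : DecidableEq StateABC := fun
  | .a, .a | .b, .b | .c, .c => isTrue rfl
  | .a, .b | .a, .c | .b, .a | .b, .c | .c, .a | .c, .b => isFalse (by simp)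

instance : Fintype StateABC := ⟨{.a, .b, .c}, by rintro (_ | _ | _) <;> decide⟩

instance {S X : Type*} [DecidableEq S] [DecidableEq X] (A : MealyAutomaton S X) (s x y t) :
    Decidable (A.arrows s x y t) :=
  inferInstanceAs (Decidable (A.step (s, x) = (y, t)))

instance {S X : Type*} (R : ArrowSet S X) (s x y t) [h : Decidable (R s x y t)] :
    Decidable (R.dual x s t y) := h

instance {S X : Type*} (R : ArrowSet S X) (s x y t) [h : Decidable (R s x y t)] :
    Decidable (R.inverse s y x t) := h

instance {S X : Type*} [Fintype S] [Fintype X] [DecidableEq S] [DecidableEq X] (R : ArrowSet S X)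
    [∀ s x y t, Decidable (R s x y t)] : Decidable R.IsAutomaton :=
  inferInstanceAs (Decidable (∀ s x, ∃ p : X × S, R s x p.1 p.2 ∧
    ∀ q : X × S, R s x q.1 q.2 → q = p))

theorem aleshin_bireversible : aleshin.Bireversible := by
  constructor <;> decide +kernel

theorem bellaterra_bireversible : bellaterra.Bireversible := by
  constructor <;> decide +kernel

theorem aleshin_activity (n : ℕ) :
    aleshin.activity n .a = 0 ∧ aleshin.activity n .b = 1 ∧ aleshin.activity n .c = 1 := by
  induction n with
  | zero => simp [MealyAutomaton.activity, aleshin]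
  | succ n ih =>
    change aleshin.activity n .b + aleshin.activity n .b = 0 ∧
      aleshin.activity n .a + aleshin.activity n .c = 1 ∧
      aleshin.activity n .c + aleshin.activity n .a = 1
    rw [ih.1, ih.2.1, ih.2.2]
    decide

/-- The pattern (0, 1, 1) reproduces itself as for the Aleshin automaton, but starts at level 1; at
level 0 only the state a is active. -/
theorem bellaterra_activity (n : ℕ) : bellaterra.activity (n + 1) .a = 0 ∧
    bellaterra.activity (n + 1) .b = 1 ∧ bellaterra.activity (n + 1) .c = 1 := by
  induction n with
  | zero => simp [MealyAutomaton.activity, bellaterra]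
  | succ n ih =>
    change bellaterra.activity (n + 1) .b + bellaterra.activity (n + 1) .b = 0 ∧
      bellaterra.activity (n + 1) .a + bellaterra.activity (n + 1) .c = 1 ∧
      bellaterra.activity (n + 1) .c + bellaterra.activity (n + 1) .a = 1
    rw [ih.1, ih.2.1, ih.2.2]
    decide

theorem mainTheorem2 :
    (∀ (S X : Type*) [Finite S] [Finite X] (A : MealyAutomaton S X) (hA : A.Bireversible),
      (Nat.card X = 2 ∨ Nat.card S = 2) →
      Infinite (A.AutomatonGroup hA.invertible) →
      ¬ Group.ResiduallyFinite A.PiOne) ∧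
    ¬ Group.ResiduallyFinite (wiseComplex.FundamentalGroup .pt) ∧
    ¬ Group.ResiduallyFinite (bellaterraComplex.FundamentalGroup .pt) := by
  refine ⟨fun S X _ _ A hA hcard hinf => ?_, ?_, ?_⟩
  · rcases hcard with hX | hS
    · exact (A.levelTransitive_of_infinite hA.invertible hX hinf).not_residuallyFinite_piOne hA hX
    · refine MealyAutomaton.LevelTransitive.not_residuallyFinite_piOne_of_dual hA
        (A.dual.levelTransitive_of_infinite hA.dual_bireversible.invertible hS ?_) hS
      by_contra hfin
      have := not_infinite_iff_finite.1 hfin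
      -- A finite dual group would make the automaton group finite.
      have := A.finite_automatonGroup_of_dual hA.invertible hA.dual_bireversible.invertible
      exact not_finite (A.AutomatonGroup hA.invertible)
  · exact (MealyAutomaton.levelTransitive_of_activity aleshin_bireversible.invertible
      fun n => ⟨.b, (aleshin_activity n).2.1⟩).not_residuallyFinite_piOne aleshin_bireversible
      (by simp)
  · refine (MealyAutomaton.levelTransitive_of_activity bellaterra_bireversible.invertible
      fun n => ?_).not_residuallyFinite_piOne bellaterra_bireversible (by simp)
    cases n with
    | zero => exact ⟨.a, by simp [MealyAutomaton.activity, bellaterra]⟩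
    | succ n => exact ⟨.b, (bellaterra_activity n).2.1⟩
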